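/- Let $m\ge 1$, let $B_r=\{x\in\mathbb R^m:|x|<r\}$, and let $u:B_1\to\mathbb R$ be harmonic. A function $f:(0,1)\to\mathbb R$ is called absolutely monotonic if it is $C^\infty$ and $f^{(k)}(r)\ge 0$ for all $r\in(0,1)$ and all integers $k\ge 0$. (a) For every smooth and nondecreasing $\varphi:[0,1]\to\mathbb R$ the integral $$d(r)=\int_{B_1}u^2(rx)\,\varphi'(|x|^2)\,dx$$ converges for every $r\in(0,1)$, and $d$ is absolutely monotonic on $(0,1)$. (b) Consequently (the continuous Lippner–Mangoubi theorem), the functions $$H_u(r)=\int_{\partial B_r}u^2\,d\sigma,\qquad \overline H_u(r)=\frac{1}{|\partial B_r|}\,H_u(r)\qquad(0<r<1),$$ where $\sigma$ is the surface measure of $\partial B_r$ (counting measure if $m=1$) and $|\partial B_r|=\sigma(\partial B_r)$, are well defined (the integrals converge) and absolutely monotonic on $(0,1)$. -/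

import Mathlib

open MeasureTheory Set Metric
open scoped ContDiff

noncomputable section

/-- The surface measure `σ` of the sphere `∂B_r(0) ⊂ ℝ^m` (for `m ≥ 1`, `r > 0`), as a measure on
`ℝ^m`: the measure `volume.toSphere` on the unit sphere (Mathlib's surface measure, the one of
polar coordinates `dx = r^(m-1) dr dσ`), transported by `θ ↦ r θ` and multiplied by `r^(m-1)`. -/
def surfaceMeasure (m : ℕ) (r : ℝ) : Measure (EuclideanSpace ℝ (Fin m)) :=
  ENNReal.ofReal (r ^ (m - 1)) •
    ((volume : Measure (EuclideanSpace ℝ (Fin m))).toSphere.map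
      fun θ : sphere (0 : EuclideanSpace ℝ (Fin m)) 1 => r • (θ : EuclideanSpace ℝ (Fin m)))

/-- `H_u(r) = ∫_{∂B_r(0)} u² dσ`. -/
def sphereH {m : ℕ} (u : EuclideanSpace ℝ (Fin m) → ℝ) (r : ℝ) : ℝ :=
  ∫ x, u x ^ 2 ∂(surfaceMeasure m r)

/-- The `L²`-growth function `H̄_u(r) = H_u(r) / |∂B_r(0)|`. -/
def sphereHbar {m : ℕ} (u : EuclideanSpace ℝ (Fin m) → ℝ) (r : ℝ) : ℝ :=
  sphereH u r / (surfaceMeasure m r).real univ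

/-- The integrand `x ↦ u²(r x) φ'(|x|²)` on `B_1(0)`, for `φ` a function on `[0, 1]`
(so the derivative `φ'` is taken within `[0, 1]`). -/
def weightedIntegrand {m : ℕ} (u : EuclideanSpace ℝ (Fin m) → ℝ) (φ : ℝ → ℝ) (r : ℝ)
    (x : EuclideanSpace ℝ (Fin m)) : ℝ :=
  u (r • x) ^ 2 * derivWithin φ (Icc 0 1) (‖x‖ ^ 2)

/-- `d(r) = ∫_{B_1(0)} u²(r x) φ'(|x|²) dx`. -/
def weightedMean {m : ℕ} (u : EuclideanSpace ℝ (Fin m) → ℝ) (φ : ℝ → ℝ) (r : ℝ) : ℝ :=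
  ∫ x in ball (0 : EuclideanSpace ℝ (Fin m)) 1, weightedIntegrand u φ r x

end

/-!
Write `S f r` (`sphereIntegral`) for the integral of `f (r θ)` over the unit sphere, and
`N_u = S (u ^ 2)`. All three functions in question are built from `N_u`:
`sphereH u r = r ^ (m - 1) * N_u r`, `sphereHbar u` is a constant multiple of `N_u`, and in polar
coordinates `d(r) = ∫₀¹ t ^ (m - 1) φ'(t ^ 2) N_u (r t) dt` with `φ' ≥ 0`. Absolute monotonicity
survives multiplication by `r` and averaging of dilates `r ↦ f (r t)` against a nonnegative weight
in `t`, so it is enough to treat `N_u`.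

For `u` harmonic, `Δ (u ^ 2) = 2 ∑ i, (∂ᵢ u) ^ 2`, and the divergence theorem on the ball of radius
`r` (`pow_mul_integral_fderiv_sphere`) becomes
`N_u' r = 2 r ∑ i, ∫₀¹ t ^ (m - 1) N_{∂ᵢ u} (r t) dt` (`hasDerivAt_sphereIntegral_sq`).
The partial derivatives `∂ᵢ u` are again harmonic, so an induction on the order of differentiation,
over all harmonic functions at once, shows that every derivative of `N_u` is nonnegative
(`absMonotoneUpTo_sphereIntegral_sq`).

Harmonic functions are a priori only `C²`, and for the `∂ᵢ u` to be harmonic they have to be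
smooth (`contDiffOn_infty_of_harmonicOnNhd`). This follows from the same divergence theorem, which
for harmonic functions gives the mean value property, so that a harmonic function is locally its own
convolution with a radial bump function.

The divergence theorem itself is obtained by testing with radial functions: integration by
parts on the whole space and polar coordinates give its weak form in the radial variable, and both
sides are continuous there.
-/

/-! ### Parametric integrals over a compact space -/

section Parametric

variable {Y : Type*} [TopologicalSpace Y] [CompactSpace Y]
  [MeasurableSpace Y] [BorelSpace Y] {μ : Measure Y} [IsFiniteMeasure μ] {U : Set ℝ}

theorem continuousOn_integral_of_compactSpace (hU : IsOpen U) {G : ℝ → Y → ℝ}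
    (hG : ContinuousOn (Function.uncurry G) (U ×ˢ univ)) :
    ContinuousOn (fun r => ∫ y, G r y ∂μ) U := by
  rw [continuousOn_iff_continuous_domRestrict]
  have : LocallyCompactSpace U := hU.locallyCompactSpace
  have h := continuous_parametric_integral_of_continuous (μ := μ) (s := univ)
    (f := fun (r : U) y => G r y)
    (hG.comp_continuous (by fun_prop : Continuous fun p : U × Y => ((p.1 : ℝ), p.2))
      fun p => ⟨p.1.2, mem_univ _⟩) isCompact_univ
  simp only [Measure.restrict_univ] at h
  exact h

theorem ContinuousOn.integrable_slice_of_compactSpace {G : ℝ → Y → ℝ}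
    (hG : ContinuousOn (Function.uncurry G) (U ×ˢ univ)) {r : ℝ} (hr : r ∈ U) :
    Integrable (G r) μ := by
  have h : Continuous (G r) :=
    hG.comp_continuous (by fun_prop : Continuous fun y : Y => (r, y)) fun y => ⟨hr, mem_univ _⟩
  exact h.integrable_of_hasCompactSupport (HasCompactSupport.of_compactSpace _)

theorem hasDerivAt_integral_of_compactSpace (hU : IsOpen U) {G G' : ℝ → Y → ℝ}
    (hG : ContinuousOn (Function.uncurry G) (U ×ˢ univ))
    (hG' : ContinuousOn (Function.uncurry G') (U ×ˢ univ))
    (hd : ∀ r ∈ U, ∀ y, HasDerivAt (fun s => G s y) (G' r y) r) {r : ℝ} (hr : r ∈ U) :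
    HasDerivAt (fun s => ∫ y, G s y ∂μ) (∫ y, G' r y ∂μ) r := by
  obtain ⟨ε, hε, hsub⟩ := nhds_basis_closedBall.mem_iff.1 (hU.mem_nhds hr)
  obtain ⟨C, hC⟩ := ((isCompact_closedBall r ε).prod
    (isCompact_univ (X := Y))).exists_bound_of_continuousOn (hG'.mono (prod_mono hsub Subset.rfl))
  refine (hasDerivAt_integral_of_dominated_loc_of_deriv_le (bound := fun _ => C)
    (closedBall_mem_nhds r hε) ?_ (hG.integrable_slice_of_compactSpace hr)
    (hG'.integrable_slice_of_compactSpace hr).aestronglyMeasurable ?_ (integrable_const C) ?_).2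
  · filter_upwards [hU.mem_nhds hr] with s hs
    exact (hG.integrable_slice_of_compactSpace hs).aestronglyMeasurable
  · exact Filter.Eventually.of_forall fun y s hs => hC (s, y) ⟨hs, mem_univ _⟩
  · exact Filter.Eventually.of_forall fun y s hs => hd s (hsub hs) y

end Parametric

/-! ### Integrals over spheres and polar coordinates -/

section Sphere

variable {E : Type*} [NormedAddCommGroup E] [InnerProductSpace ℝ E]

theorem smul_sphere_mem_ball {r R : ℝ} (hr : r ∈ Ioo (-R) R) (θ : sphere (0 : E) 1) :
    r • (θ : E) ∈ ball (0 : E) R := by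
  simpa [norm_smul, abs_lt] using hr

theorem continuousOn_smul_sphere {f : E → ℝ} {R : ℝ} (hf : ContinuousOn f (ball 0 R)) :
    ContinuousOn (Function.uncurry fun (r : ℝ) (θ : sphere (0 : E) 1) => f (r • (θ : E)))
      (Ioo (-R) R ×ˢ univ) :=
  hf.comp (by fun_prop) fun p hp => smul_sphere_mem_ball hp.1 p.2

theorem continuousOn_fderiv_smul_sphere {f : E → ℝ} {R : ℝ} (hf : ContDiffOn ℝ 1 f (ball 0 R)) :
    ContinuousOn (Function.uncurry fun (r : ℝ) (θ : sphere (0 : E) 1) =>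
      fderiv ℝ f (r • (θ : E)) (θ : E)) (Ioo (-R) R ×ˢ univ) := by
  have h := hf.continuousOn_fderiv_of_isOpen isOpen_ball le_rfl
  have h1 : ContinuousOn (fun p : ℝ × sphere (0 : E) 1 => fderiv ℝ f (p.1 • (p.2 : E)))
      (Ioo (-R) R ×ˢ univ) :=
    h.comp (by fun_prop) fun p hp => smul_sphere_mem_ball hp.1 p.2
  exact h1.clm_apply (by fun_prop)

variable [FiniteDimensional ℝ E] [MeasurableSpace E] [BorelSpace E]

/-- The integral of `f` over the sphere of radius `r` about the origin, with respect to the surface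
measure of the *unit* sphere; thus the weight `r ^ (dim E - 1)` is left out, and the function is
defined for negative `r` too. -/
noncomputable def sphereIntegral (f : E → ℝ) (r : ℝ) : ℝ :=
  ∫ θ : sphere (0 : E) 1, f (r • (θ : E)) ∂(volume : Measure E).toSphere

theorem continuousOn_sphereIntegral {f : E → ℝ} {R : ℝ} (hf : ContinuousOn f (ball 0 R)) :
    ContinuousOn (sphereIntegral f) (Ioo (-R) R) :=
  continuousOn_integral_of_compactSpace isOpen_Ioo (continuousOn_smul_sphere hf)

theorem integrable_smul_sphere {f : E → ℝ} {R : ℝ} (hf : ContinuousOn f (ball 0 R)) {r : ℝ}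
    (hr : r ∈ Ioo (-R) R) :
    Integrable (fun θ : sphere (0 : E) 1 => f (r • (θ : E))) (volume : Measure E).toSphere :=
  (continuousOn_smul_sphere hf).integrable_slice_of_compactSpace hr

theorem hasDerivAt_sphereIntegral {f : E → ℝ} {R : ℝ} (hf : ContDiffOn ℝ 1 f (ball 0 R)) {r : ℝ}
    (hr : r ∈ Ioo (-R) R) :
    HasDerivAt (sphereIntegral f)
      (∫ θ : sphere (0 : E) 1, fderiv ℝ f (r • (θ : E)) θ ∂(volume : Measure E).toSphere) r := by
  refine hasDerivAt_integral_of_compactSpace isOpen_Ioo (continuousOn_smul_sphere hf.continuousOn)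
    (continuousOn_fderiv_smul_sphere hf) (fun s hs θ => ?_) hr
  have h1 : HasFDerivAt f (fderiv ℝ f (s • (θ : E))) (s • (θ : E)) :=
    ((hf.differentiableOn one_ne_zero).differentiableAt
      (isOpen_ball.mem_nhds (smul_sphere_mem_ball hs θ))).hasFDerivAt
  have h2 : HasDerivAt (fun t : ℝ => t • (θ : E)) (θ : E) s := by
    simpa using (hasDerivAt_id s).smul_const (θ : E)
  exact h1.comp_hasDerivAt s h2

/-- Integration in polar coordinates. -/
theorem integral_eq_integral_sphereIntegral [Nontrivial E] {f : E → ℝ} (hf : Integrable f) :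
    ∫ x, f x = ∫ t in Ioi (0 : ℝ), t ^ (Module.finrank ℝ E - 1) * sphereIntegral f t := by
  set n := Module.finrank ℝ E - 1
  have hmp := (volume : Measure E).measurePreserving_homeomorphUnitSphereProd
  have hemb := (homeomorphUnitSphereProd E).measurableEmbedding
  let F : sphere (0 : E) 1 × Ioi (0 : ℝ) → ℝ := fun p => f ((p.2 : ℝ) • (p.1 : E))
  have hF : F ∘ homeomorphUnitSphereProd E = fun x : ({0}ᶜ : Set E) => f x := by
    funext x
    have := congrArg Subtype.val ((homeomorphUnitSphereProd E).symm_apply_apply x)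
    rw [homeomorphUnitSphereProd_symm_apply_coe] at this
    exact congrArg f this
  have hint : Integrable F ((volume : Measure E).toSphere.prod (Measure.volumeIoiPow n)) := by
    rw [← hmp.integrable_comp_emb hemb, hF]
    refine (integrableOn_iff_comap_subtypeVal (by measurability)).1 ?_
    exact hf.integrableOn
  calc ∫ x, f x = ∫ x : ({0}ᶜ : Set E), f x ∂((volume : Measure E).comap (↑)) := by
        rw [integral_subtype_comap (measurableSet_singleton _).compl, restrict_compl_singleton]
    _ = ∫ p, F p ∂((volume : Measure E).toSphere.prod (Measure.volumeIoiPow n)) := by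
        rw [← hmp.integral_comp hemb]
        exact congrArg (fun g => ∫ x, g x ∂((volume : Measure E).comap (↑))) hF.symm
    _ = ∫ t : Ioi (0 : ℝ), sphereIntegral f t ∂(Measure.volumeIoiPow n) :=
        integral_prod_symm F hint
    _ = _ := by
        simp only [Measure.volumeIoiPow, ENNReal.ofReal]
        rw [integral_withDensity_eq_integral_smul,
          integral_subtype_comap measurableSet_Ioi
            fun a ↦ Real.toNNReal (a ^ n) • sphereIntegral f a,
          setIntegral_congr_fun measurableSet_Ioi fun x hx ↦ ?_]
        · simp only [NNReal.smul_def, Real.coe_toNNReal _ (pow_nonneg hx.out.le n), smul_eq_mul]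
        · exact (measurable_subtype_coe.pow_const _).real_toNNReal

end Sphere

/-! ### The divergence theorem on balls -/

section Divergence

open InnerProductSpace Laplacian

variable {E : Type*} [NormedAddCommGroup E] [InnerProductSpace ℝ E]

theorem ContDiffAt.differentiableAt_fderiv_apply {w : E → ℝ} {x : E} (hw : ContDiffAt ℝ 2 w x)
    (v : E) : DifferentiableAt ℝ (fun y => fderiv ℝ w y v) x :=
  ((hw.fderiv_right (m := 1) le_rfl).differentiableAt one_ne_zero).clm_apply
    (differentiableAt_const v)

theorem ContDiffOn.continuousOn_fderiv_apply {w : E → ℝ} {U : Set E} (hU : IsOpen U)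
    (hw : ContDiffOn ℝ 1 w U) (v : E) : ContinuousOn (fun y => fderiv ℝ w y v) U :=
  (hw.continuousOn_fderiv_of_isOpen hU le_rfl).clm_apply continuousOn_const

theorem ContDiffOn.fderiv_apply_of_isOpen {w : E → ℝ} {U : Set E} (hU : IsOpen U) {n m : ℕ∞ω}
    (hw : ContDiffOn ℝ n w U) (hmn : m + 1 ≤ n) (v : E) :
    ContDiffOn ℝ m (fun y => fderiv ℝ w y v) U :=
  (hw.fderiv_of_isOpen hU hmn).clm_apply contDiffOn_const

variable [FiniteDimensional ℝ E]

theorem laplacian_eq_sum_fderiv_fderiv {ι : Type*} [Fintype ι] (b : OrthonormalBasis ι ℝ E)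
    {w : E → ℝ} {x : E} (hw : ContDiffAt ℝ 2 w x) :
    Δ w x = ∑ i, fderiv ℝ (fun y => fderiv ℝ w y (b i)) x (b i) := by
  rw [laplacian_eq_iteratedFDeriv_orthonormalBasis w b]
  refine Finset.sum_congr rfl fun i _ => ?_
  have hd := (hw.fderiv_right (m := 1) le_rfl).differentiableAt one_ne_zero
  rw [iteratedFDeriv_two_apply, fderiv_clm_apply hd (differentiableAt_const _)]
  simp

theorem ContDiffOn.continuousOn_laplacian {w : E → ℝ} {U : Set E} (hU : IsOpen U)
    (hw : ContDiffOn ℝ 2 w U) : ContinuousOn (Δ w) U := by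
  have h : ContinuousOn (fun x => ∑ i, fderiv ℝ (fun y => fderiv ℝ w y (stdOrthonormalBasis ℝ E i))
      x (stdOrthonormalBasis ℝ E i)) U :=
    continuousOn_finsetSum _ fun i _ =>
      (hw.fderiv_apply_of_isOpen hU (m := 1) le_rfl _).continuousOn_fderiv_apply hU _
  exact h.congr fun x hx =>
    laplacian_eq_sum_fderiv_fderiv _ (hw.contDiffAt (hU.mem_nhds hx))

variable [MeasurableSpace E] [BorelSpace E]

theorem ContinuousOn.integrable_of_support_subset_closedBall {F : E → ℝ} {a R : ℝ} (haR : a < R)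
    (hF : ContinuousOn F (ball 0 R)) (h0 : ∀ x, a < ‖x‖ → F x = 0) : Integrable F := by
  have h : IntegrableOn F (closedBall 0 a) :=
    (hF.mono (closedBall_subset_ball haR)).integrableOn_compact (isCompact_closedBall _ _)
  refine (integrableOn_iff_integrable_of_support_subset fun x hx => ?_).1 h
  by_contra hxa
  exact hx (h0 x (by simpa using hxa))

/-- Green's identity for a radial test function `x ↦ k (‖x‖ ^ 2)` supported in a ball. -/
theorem integral_radial_mul_laplacian {w : E → ℝ} {a R : ℝ} (ha : 0 ≤ a) (haR : a < R)
    (hw : ContDiffOn ℝ 2 w (ball 0 R)) {k ζ : ℝ → ℝ} (hζ : Continuous ζ)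
    (hk : ∀ t, HasDerivAt k (ζ t) t) (hk0 : ∀ t, a ^ 2 ≤ t → k t = 0)
    (hζ0 : ∀ t, a ^ 2 ≤ t → ζ t = 0) :
    ∫ x, k (‖x‖ ^ 2) * Δ w x = - ∫ x, 2 * ζ (‖x‖ ^ 2) * fderiv ℝ w x x := by
  set b := stdOrthonormalBasis ℝ E
  have hkc : Continuous k := continuous_iff_continuousAt.2 fun t => (hk t).continuousAt
  have hsq : ∀ x : E, a < ‖x‖ → a ^ 2 ≤ ‖x‖ ^ 2 := fun x hx => by gcongr
  have hΨ : ∀ x : E, HasFDerivAt (fun y : E => k (‖y‖ ^ 2))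
      (ζ (‖x‖ ^ 2) • (2 • innerSL ℝ x)) x := fun x => by
    exact (hk (‖x‖ ^ 2)).comp_hasFDerivAt x (hasStrictFDerivAt_norm_sq x).hasFDerivAt
  have hts : tsupport (fun y : E => k (‖y‖ ^ 2)) ⊆ ball 0 R := by
    refine (closure_minimal (fun x hx => ?_) isClosed_closedBall).trans (closedBall_subset_ball haR)
    by_contra hxa
    exact hx (hk0 _ (hsq x (by simpa using hxa)))
  have hw1 : ∀ i, ContDiffOn ℝ 1 (fun y => fderiv ℝ w y (b i)) (ball 0 R) := fun i =>
    hw.fderiv_apply_of_isOpen isOpen_ball le_rfl _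
  have hat : ∀ x ∈ ball (0 : E) R, ContDiffAt ℝ 2 w x := fun x hx =>
    hw.contDiffAt (isOpen_ball.mem_nhds hx)
  have hf' : ∀ (x : E) i, fderiv ℝ (fun y : E => k (‖y‖ ^ 2)) x (b i)
      = 2 * ζ (‖x‖ ^ 2) * inner ℝ x (b i) := fun x i => by
    rw [(hΨ x).fderiv]; simp; ring
  have hi1 : ∀ i, Integrable fun x => k (‖x‖ ^ 2) *
      fderiv ℝ (fun y => fderiv ℝ w y (b i)) x (b i) := fun i =>
    ContinuousOn.integrable_of_support_subset_closedBall haR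
      ((by fun_prop : Continuous fun x : E => k (‖x‖ ^ 2)).continuousOn.mul
        ((hw1 i).continuousOn_fderiv_apply isOpen_ball _))
      fun x hx => by simp [hk0 _ (hsq x hx)]
  have hi2 : ∀ i, Integrable fun x => 2 * ζ (‖x‖ ^ 2) * inner ℝ x (b i) *
      fderiv ℝ w x (b i) := fun i =>
    ContinuousOn.integrable_of_support_subset_closedBall haR
      ((by fun_prop : Continuous fun x : E => 2 * ζ (‖x‖ ^ 2) * inner ℝ x (b i)).continuousOn.mul
        (hw1 i).continuousOn)
      fun x hx => by simp [hζ0 _ (hsq x hx)]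
  have hi3 : ∀ i, Integrable fun x => k (‖x‖ ^ 2) * fderiv ℝ w x (b i) := fun i =>
    ContinuousOn.integrable_of_support_subset_closedBall haR
      ((by fun_prop : Continuous fun x : E => k (‖x‖ ^ 2)).continuousOn.mul
        (hw1 i).continuousOn)
      fun x hx => by simp [hk0 _ (hsq x hx)]
  have hibp : ∀ i, ∫ x, k (‖x‖ ^ 2) * fderiv ℝ (fun y => fderiv ℝ w y (b i)) x (b i)
      = - ∫ x, 2 * ζ (‖x‖ ^ 2) * inner ℝ x (b i) * fderiv ℝ w x (b i) := fun i => by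
    have := integral_mul_fderiv_eq_neg_fderiv_mul_of_integrable (μ := (volume : Measure E))
      (f := fun x : E => k (‖x‖ ^ 2)) (g := fun x => fderiv ℝ w x (b i)) (v := b i)
      (by simpa only [hf'] using hi2 i) (hi1 i) (hi3 i) (fun x _ => (hΨ x).differentiableAt)
      (fun x hx => (hat x (hts hx)).differentiableAt_fderiv_apply _)
    simpa only [hf'] using this
  calc ∫ x, k (‖x‖ ^ 2) * Δ w x
      = ∫ x, ∑ i, k (‖x‖ ^ 2) * fderiv ℝ (fun y => fderiv ℝ w y (b i)) x (b i) := by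
        refine integral_congr_ae (Filter.Eventually.of_forall fun x => ?_)
        by_cases hx : x ∈ ball (0 : E) R
        · simp only [laplacian_eq_sum_fderiv_fderiv b (hat x hx), Finset.mul_sum]
        · have : k (‖x‖ ^ 2) = 0 := hk0 _ (hsq x (haR.trans_le (by simpa using hx)))
          simp [this]
    _ = - ∫ x, ∑ i, 2 * ζ (‖x‖ ^ 2) * inner ℝ x (b i) * fderiv ℝ w x (b i) := by
        rw [integral_finsetSum _ fun i _ => hi1 i, integral_finsetSum _ fun i _ => hi2 i,
          ← Finset.sum_neg_distrib]
        exact Finset.sum_congr rfl fun i _ => hibp i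
    _ = _ := by
        congr 1
        refine integral_congr_ae (Filter.Eventually.of_forall fun x => ?_)
        have hx : fderiv ℝ w x x = ∑ i, inner ℝ (b i) x * fderiv ℝ w x (b i) := by
          conv_lhs => arg 2; rw [← b.sum_repr' x]
          simp only [map_sum, map_smul, smul_eq_mul]
        simp only [hx, Finset.mul_sum]
        exact Finset.sum_congr rfl fun i _ => by rw [real_inner_comm]; ring

theorem sphereIntegral_radial_mul (g : ℝ → ℝ) (f : E → ℝ) (t : ℝ) :
    sphereIntegral (fun x => g (‖x‖ ^ 2) * f x) t = g (t ^ 2) * sphereIntegral f t := by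
  rw [sphereIntegral, sphereIntegral, ← integral_const_mul]
  simp [norm_smul]

/-- The divergence theorem for the gradient field of `w` on the ball of radius `r`, both sides
being written in polar coordinates. -/
theorem pow_mul_integral_fderiv_sphere [Nontrivial E] {w : E → ℝ} {R : ℝ}
    (hw : ContDiffOn ℝ 2 w (ball 0 R)) {r : ℝ} (hr : r ∈ Ioo 0 R) :
    r ^ (Module.finrank ℝ E - 1) *
        ∫ θ : sphere (0 : E) 1, fderiv ℝ w (r • (θ : E)) θ ∂(volume : Measure E).toSphere
      = ∫ s in (0 : ℝ)..r, s ^ (Module.finrank ℝ E - 1) * sphereIntegral (Δ w) s := by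
  set n := Module.finrank ℝ E - 1
  set M' : ℝ → ℝ := fun s =>
    ∫ θ : sphere (0 : E) 1, fderiv ℝ w (s • (θ : E)) θ ∂(volume : Measure E).toSphere with hM'
  obtain ⟨a, hra, haR⟩ := exists_between hr.2
  have ha : 0 < a := hr.1.trans hra
  set q : ℝ → ℝ := fun s => s ^ n * sphereIntegral (Δ w) s with hq
  have hqc : ContinuousOn q (Ioo (-R) R) :=
    (continuous_pow n).continuousOn.mul
      (continuousOn_sphereIntegral (hw.continuousOn_laplacian isOpen_ball))
  have hM'c : ContinuousOn M' (Ioo (-R) R) :=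
    continuousOn_integral_of_compactSpace isOpen_Ioo
      (continuousOn_fderiv_smul_sphere (hw.of_le one_le_two))
  set K : ℝ → ℝ := fun t => ∫ s in (0 : ℝ)..t, q s with hK
  have hsub : ∀ t ∈ Icc 0 a, uIcc 0 t ⊆ Ioo (-R) R := fun t ht => by
    rw [uIcc_of_le ht.1]
    exact fun s hs => ⟨by linarith [hs.1], by linarith [hs.2, ht.2]⟩
  have hIcc : Icc 0 a ⊆ Ioo (-R) R := fun s hs => ⟨by linarith [hs.1], by linarith [hs.2]⟩
  have hKd : ∀ t ∈ Icc 0 a, HasDerivAt K (q t) t := fun t ht =>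
    intervalIntegral.integral_hasDerivAt_right (hqc.mono (hsub t ht)).intervalIntegrable
      (hqc.stronglyMeasurableAtFilter isOpen_Ioo t (hIcc ht))
      (hqc.continuousAt (isOpen_Ioo.mem_nhds (hIcc ht)))
  have hKc : ContinuousOn K (Icc 0 a) := fun t ht => (hKd t ht).continuousAt.continuousWithinAt
  set f : ℝ → ℝ := fun t => K t - t ^ n * M' t with hf
  have hfc : ContinuousOn f (Icc 0 a) :=
    hKc.sub ((continuous_pow n).continuousOn.mul (hM'c.mono hIcc))
  -- The test function is built from the defect `f` itself, so that the weak identity says that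
  -- a nonnegative multiple of `f ^ 2` has integral zero.
  set ζ : ℝ → ℝ := fun s => f (√(min s (a ^ 2))) * max (a ^ 2 - s) 0 with hζ
  have hζc : Continuous ζ := by
    refine (hfc.comp_continuous (by fun_prop) fun s => ⟨Real.sqrt_nonneg _, ?_⟩).mul (by fun_prop)
    exact Real.sqrt_le_iff.2 ⟨ha.le, min_le_right _ _⟩
  have hζ0 : ∀ t, a ^ 2 ≤ t → ζ t = 0 := fun t ht => by
    simp [hζ, ht]
  have hζsq : ∀ t ∈ Icc 0 a, ζ (t ^ 2) = f t * (a ^ 2 - t ^ 2) := fun t ht => by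
    have h : t ^ 2 ≤ a ^ 2 := pow_le_pow_left₀ ht.1 ht.2 2
    simp only [hζ, min_eq_left h, max_eq_left (sub_nonneg.2 h), Real.sqrt_sq ht.1]
  set k : ℝ → ℝ := fun t => ∫ s in (a ^ 2)..t, ζ s with hk
  have hkd : ∀ t, HasDerivAt k (ζ t) t := fun t => (hζc.integral_hasStrictDerivAt _ t).hasDerivAt
  have hkc : Continuous k := continuous_iff_continuousAt.2 fun t => (hkd t).continuousAt
  have hk0 : ∀ t, a ^ 2 ≤ t → k t = 0 := fun t ht => by
    refine (intervalIntegral.integral_congr fun s hs => ?_).trans intervalIntegral.integral_zero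
    rw [uIcc_of_le ht] at hs
    exact hζ0 s hs.1
  have hpolar : ∀ (g : ℝ → ℝ) (F : E → ℝ), Continuous g → ContinuousOn F (ball 0 R) →
      (∀ t, a ^ 2 ≤ t → g t = 0) →
      ∫ x, g (‖x‖ ^ 2) * F x
        = ∫ t in (0 : ℝ)..a, t ^ n * (g (t ^ 2) * sphereIntegral F t) := by
    intro g F hg hF hg0
    rw [integral_eq_integral_sphereIntegral, intervalIntegral.integral_of_le ha.le]
    · rw [setIntegral_congr_fun measurableSet_Ioi (g := fun t =>
        t ^ n * (g (t ^ 2) * sphereIntegral F t))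
        fun t _ => by simp only [sphereIntegral_radial_mul g F t]; rfl]
      refine setIntegral_eq_of_subset_of_forall_sdiff_eq_zero measurableSet_Ioi
        Ioc_subset_Ioi_self fun t ht => ?_
      have hta : a < t := by
        by_contra h
        exact ht.2 ⟨ht.1, not_lt.1 h⟩
      simp [hg0 (t ^ 2) (by gcongr)]
    · refine ContinuousOn.integrable_of_support_subset_closedBall haR
        ((by fun_prop : Continuous fun x : E => g (‖x‖ ^ 2)).continuousOn.mul hF) fun x hx => ?_
      simp [hg0 (‖x‖ ^ 2) (by gcongr)]
  have hgreen := integral_radial_mul_laplacian ha.le haR hw hζc hkd hk0 hζ0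
  rw [hpolar k _ hkc (hw.continuousOn_laplacian isOpen_ball) hk0,
    hpolar (fun t => 2 * ζ t) (fun x => fderiv ℝ w x x) (by fun_prop)
      ((hw.continuousOn_fderiv_of_isOpen isOpen_ball one_le_two).clm_apply continuousOn_id)
      (fun t ht => by simp [hζ0 t ht])] at hgreen
  have hrad : ∀ t, sphereIntegral (fun x => fderiv ℝ w x x) t = t * M' t := fun t => by
    rw [sphereIntegral, hM', ← integral_const_mul]
    simp
  have hparts : ∫ t in (0 : ℝ)..a, k (t ^ 2) * q t
      = - ∫ t in (0 : ℝ)..a, (ζ (t ^ 2) * (2 * t)) * K t := by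
    rw [intervalIntegral.integral_mul_deriv_eq_deriv_mul (u := fun t => k (t ^ 2))
      (u' := fun t => ζ (t ^ 2) * (2 * t)) (v := K) (v' := q)]
    · simp [hk0 (a ^ 2) le_rfl, hK]
    · intro t _
      have h := (hkd (t ^ 2)).comp t (hasDerivAt_pow 2 t)
      simp only [Nat.cast_ofNat, Nat.add_one_sub_one, pow_one] at h
      exact h
    · intro t ht
      rw [uIcc_of_le ha.le] at ht
      exact hKd t ht
    · exact (by fun_prop : Continuous fun t => ζ (t ^ 2) * (2 * t)).intervalIntegrable _ _
    · exact (hqc.mono (hsub a ⟨ha.le, le_rfl⟩)).intervalIntegrable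
  have hzero : ∫ t in (0 : ℝ)..a, 2 * t * (a ^ 2 - t ^ 2) * f t ^ 2 = 0 := by
    have e1 : ∫ t in (0 : ℝ)..a, t ^ n * (k (t ^ 2) * sphereIntegral (Δ w) t)
        = ∫ t in (0 : ℝ)..a, k (t ^ 2) * q t :=
      intervalIntegral.integral_congr fun t _ => by simp only [hq]; ring
    have e2 : ∫ t in (0 : ℝ)..a, t ^ n * (2 * ζ (t ^ 2) *
          sphereIntegral (fun x => fderiv ℝ w x x) t)
        = ∫ t in (0 : ℝ)..a, (ζ (t ^ 2) * (2 * t)) * (t ^ n * M' t) :=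
      intervalIntegral.integral_congr fun t _ => by simp only [hrad]; ring
    rw [e1, e2, hparts, neg_inj] at hgreen
    refine Eq.trans ?_ (sub_eq_zero.2 hgreen)
    rw [← intervalIntegral.integral_sub]
    · refine intervalIntegral.integral_congr fun t ht => ?_
      rw [uIcc_of_le ha.le] at ht
      simp only [hζsq t ht, hf]
      ring
    all_goals
      refine ContinuousOn.intervalIntegrable ?_
      rw [uIcc_of_le ha.le]
      refine (by fun_prop : Continuous fun t => ζ (t ^ 2) * (2 * t)).continuousOn.mul ?_
    · exact hKc
    · exact (continuous_pow n).continuousOn.mul (hM'c.mono hIcc)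
  have hfr : f r = 0 := by
    by_contra hne
    have hlt := intervalIntegral.integral_lt_integral_of_continuousOn_of_le_of_exists_lt ha
      (f := fun _ => (0 : ℝ)) (g := fun t => 2 * t * (a ^ 2 - t ^ 2) * f t ^ 2)
      continuousOn_const
      ((by fun_prop : Continuous fun t : ℝ => 2 * t * (a ^ 2 - t ^ 2)).continuousOn.mul (hfc.pow 2))
      (fun t ht => by
        have : t ^ 2 ≤ a ^ 2 := pow_le_pow_left₀ ht.1.le ht.2 2
        exact mul_nonneg (mul_nonneg (by linarith [ht.1]) (by linarith)) (sq_nonneg _))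
      ⟨r, ⟨hr.1.le, hra.le⟩, by
        have : r ^ 2 < a ^ 2 := pow_lt_pow_left₀ hra hr.1.le two_ne_zero
        have h1 : 0 < 2 * r * (a ^ 2 - r ^ 2) := mul_pos (by linarith [hr.1]) (by linarith)
        positivity⟩
    simp [hzero] at hlt
  exact (sub_eq_zero.1 hfr).symm

end Divergence

/-! ### Mean value property and smoothness of harmonic functions -/

section Regularity

open InnerProductSpace Laplacian

variable {E : Type*} [NormedAddCommGroup E] [InnerProductSpace ℝ E] [FiniteDimensional ℝ E]

theorem laplacian_comp_add_left (u : E → ℝ) (y z : E) :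
    Δ (fun x => u (y + x)) z = Δ u (y + z) := by
  simp only [laplacian_eq_iteratedFDeriv_stdOrthonormalBasis, iteratedFDeriv_comp_add_left]

variable [MeasurableSpace E] [BorelSpace E]

/-- The **mean value property** of harmonic functions. -/
theorem sphereIntegral_eq_of_laplacian_eq_zero [Nontrivial E] {w : E → ℝ} {R : ℝ}
    (hw : ContDiffOn ℝ 2 w (ball 0 R)) (hΔ : ∀ x ∈ ball 0 R, Δ w x = 0) {r : ℝ}
    (hr : r ∈ Ioo 0 R) :
    sphereIntegral w r = sphereIntegral (fun _ : E => w 0) r := by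
  have hsub : Icc 0 r ⊆ Ioo (-R) R := fun s hs =>
    ⟨by linarith [hs.1, hr.1, hr.2], by linarith [hs.2, hr.2]⟩
  -- The mean value theorem avoids having to know the derivative at the endpoint `0`.
  obtain ⟨c, hc, hslope⟩ := exists_hasDerivAt_eq_slope (sphereIntegral w)
    (fun s => ∫ θ : sphere (0 : E) 1, fderiv ℝ w (s • (θ : E)) θ ∂(volume : Measure E).toSphere)
    hr.1
    ((continuousOn_sphereIntegral hw.continuousOn).mono hsub)
    fun s hs => hasDerivAt_sphereIntegral (hw.of_le one_le_two) (hsub ⟨hs.1.le, hs.2.le⟩)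
  have hdiv := pow_mul_integral_fderiv_sphere hw ⟨hc.1, hc.2.trans hr.2⟩
  rw [intervalIntegral.integral_congr (g := fun _ => (0 : ℝ)), intervalIntegral.integral_zero,
    hslope] at hdiv
  · have h0 := (mul_eq_zero.1 hdiv).resolve_left (pow_ne_zero _ hc.1.ne')
    rw [div_eq_zero_iff, sub_zero] at h0
    rw [sub_eq_zero.1 (h0.resolve_right hr.1.ne')]
    simp [sphereIntegral]
  · intro s hs
    rw [uIcc_of_le hc.1.le] at hs
    have : ∀ θ : sphere (0 : E) 1, Δ w (s • (θ : E)) = 0 := fun θ =>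
      hΔ _ (smul_sphere_mem_ball (hsub ⟨hs.1, hs.2.trans hc.2.le⟩) θ)
    simp [sphereIntegral, this]

/-- Averaging a harmonic function against a radial weight reproduces the value at the center. -/
theorem integral_radial_mul_of_laplacian_eq_zero [Nontrivial E] {w : E → ℝ} {a R : ℝ}
    (haR : a < R) (ha : 0 ≤ a) (hw : ContDiffOn ℝ 2 w (ball 0 R))
    (hΔ : ∀ x ∈ ball 0 R, Δ w x = 0)
    {g : ℝ → ℝ} (hg : Continuous g) (hg0 : ∀ t, a ^ 2 ≤ t → g t = 0) :
    ∫ x, g (‖x‖ ^ 2) * w x = (∫ x : E, g (‖x‖ ^ 2)) * w 0 := by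
  have hint : ∀ F : E → ℝ, ContinuousOn F (ball 0 R) →
      Integrable fun x => g (‖x‖ ^ 2) * F x := fun F hF => by
    refine ContinuousOn.integrable_of_support_subset_closedBall haR
      ((by fun_prop : Continuous fun x : E => g (‖x‖ ^ 2)).continuousOn.mul hF) fun x hx => ?_
    simp [hg0 (‖x‖ ^ 2) (by gcongr)]
  rw [← integral_mul_const, integral_eq_integral_sphereIntegral (hint w hw.continuousOn),
    integral_eq_integral_sphereIntegral (hint _ continuousOn_const)]
  refine setIntegral_congr_fun measurableSet_Ioi fun t ht => ?_
  simp only [sphereIntegral_radial_mul]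
  by_cases hta : a ≤ t
  · simp [hg0 (t ^ 2) (by gcongr)]
  · rw [sphereIntegral_eq_of_laplacian_eq_zero hw hΔ ⟨ht, (not_le.1 hta).trans haR⟩]

/-- Harmonic functions, a priori only `C²`, are smooth: by the mean value property they are locally
equal to their convolution with a radial bump function. -/
theorem contDiffOn_infty_of_harmonicOnNhd [Nontrivial E] {u : E → ℝ} {U : Set E} (hU : IsOpen U)
    (hu : HarmonicOnNhd u U) : ContDiffOn ℝ ∞ u U := by
  intro x hx
  obtain ⟨δ, hδ, hsub⟩ := nhds_basis_closedBall.mem_iff.1 (hU.mem_nhds hx)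
  obtain ⟨ε, hε, hε3⟩ : ∃ ε : ℝ, 0 < ε ∧ 3 * ε = δ := ⟨δ / 3, by positivity, by ring⟩
  set g : ℝ → ℝ := fun t => Real.smoothTransition (ε ^ 2 - t) with hg
  have hgs : ContDiff ℝ ∞ g := Real.smoothTransition.contDiff.comp (by fun_prop)
  have hg0 : ∀ t, ε ^ 2 ≤ t → g t = 0 := fun t ht =>
    Real.smoothTransition.zero_of_nonpos (by linarith)
  set η : E → ℝ := fun z => g (‖z‖ ^ 2) with hη
  have hηs : ContDiff ℝ ∞ η := hgs.comp (contDiff_norm_sq ℝ)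
  have hη0 : ∀ z : E, z ∉ closedBall 0 ε → η z = 0 := fun z hz => hg0 _ (by
    have : ε < ‖z‖ := by simpa using hz
    gcongr)
  have hηc : HasCompactSupport η :=
    HasCompactSupport.intro (isCompact_closedBall 0 ε) hη0
  have hpos : 0 < ∫ z, η z :=
    hηs.continuous.integral_pos_of_hasCompactSupport_nonneg_nonzero hηc
      (fun z => Real.smoothTransition.nonneg _)
      (x := 0) (Real.smoothTransition.pos_of_pos (by simpa using pow_pos hε 2)).ne'
  set V : E → ℝ := (closedBall x δ).indicator u with hV
  have hVi : LocallyIntegrable V :=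
    (((hu.continuousOn.mono hsub).integrableOn_compact
      (isCompact_closedBall _ _)).integrable_indicator measurableSet_closedBall).locallyIntegrable
  have hconv : ContDiff ℝ ∞ (convolution η V (ContinuousLinearMap.lsmul ℝ ℝ) volume) :=
    hηc.contDiff_convolution_left _ hηs hVi
  have heq : ∀ y ∈ ball x ε, u y =
      (∫ z, η z)⁻¹ * convolution η V (ContinuousLinearMap.lsmul ℝ ℝ) volume y := by
    intro y hy
    have hyz : ∀ z ∈ ball (0 : E) (2 * ε), y + z ∈ closedBall x δ := fun z hz => by
      rw [mem_closedBall, dist_eq_norm]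
      rw [mem_ball, dist_eq_norm] at hy
      rw [mem_ball_zero_iff] at hz
      calc ‖y + z - x‖ = ‖(y - x) + z‖ := by congr 1; abel
        _ ≤ ‖y - x‖ + ‖z‖ := norm_add_le _ _
        _ ≤ δ := by linarith
    have hmv := integral_radial_mul_of_laplacian_eq_zero (w := fun z => u (y + z))
      (a := ε) (R := 2 * ε) (by linarith) hε.le
      (fun z hz => (ContDiffAt.comp z (hu _ (hsub (hyz z hz))).1
        (by fun_prop)).contDiffWithinAt)
      (fun z hz => by
        rw [laplacian_comp_add_left]
        exact (hu _ (hsub (hyz z hz))).2.eq_of_nhds)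
      hgs.continuous hg0
    have hcv : convolution η V (ContinuousLinearMap.lsmul ℝ ℝ) volume y
        = ∫ z, g (‖z‖ ^ 2) * u (y + z) := by
      rw [convolution_def, ← integral_neg_eq_self]
      refine integral_congr_ae (Filter.Eventually.of_forall fun z => ?_)
      by_cases hz : z ∈ closedBall (0 : E) ε
      · have hz' : z ∈ ball (0 : E) (2 * ε) := closedBall_subset_ball (by linarith) hz
        simp [hη, hV, indicator_of_mem (hyz z hz')]
      · have := hη0 z hz
        simp only [hη] at this
        simp [hη, this]
    rw [hcv, hmv, add_zero, ← mul_assoc, inv_mul_cancel₀ hpos.ne', one_mul]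
  have hloc : u =ᶠ[nhds x] fun y =>
      (∫ z, η z)⁻¹ * convolution η V (ContinuousLinearMap.lsmul ℝ ℝ) volume y :=
    Filter.eventually_of_mem (ball_mem_nhds x hε) heq
  exact ((contDiff_const.mul hconv).contDiffAt.congr_of_eventuallyEq hloc).contDiffWithinAt

end Regularity

/-! ### Derivatives and squares of harmonic functions -/

section Harmonic

open InnerProductSpace Laplacian

variable {E : Type*} [NormedAddCommGroup E] [InnerProductSpace ℝ E]

theorem ContDiffAt.fderiv_fderiv_apply_comm {w : E → ℝ} {x : E} (hw : ContDiffAt ℝ 2 w x)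
    (v v' : E) :
    fderiv ℝ (fun y => fderiv ℝ w y v) x v' = fderiv ℝ (fun y => fderiv ℝ w y v') x v := by
  have hd := (hw.fderiv_right (m := 1) le_rfl).differentiableAt one_ne_zero
  have hs : IsSymmSndFDerivAt ℝ w x := hw.isSymmSndFDerivAt (by simp)
  rw [fderiv_clm_apply hd (differentiableAt_const _),
    fderiv_clm_apply hd (differentiableAt_const _)]
  simpa using hs v' v

variable [FiniteDimensional ℝ E]

/-- For harmonic `u` only the first sum remains; this is the source of all nonnegativity below. -/
theorem laplacian_sq {u : E → ℝ} {x : E} (hu : ContDiffAt ℝ 2 u x) {ι : Type*} [Fintype ι]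
    (b : OrthonormalBasis ι ℝ E) :
    Δ (fun y => u y ^ 2) x = ∑ i, 2 * fderiv ℝ u x (b i) ^ 2 + 2 * u x * Δ u x := by
  rw [laplacian_eq_sum_fderiv_fderiv b (hu.pow 2), laplacian_eq_sum_fderiv_fderiv b hu,
    Finset.mul_sum, ← Finset.sum_add_distrib]
  refine Finset.sum_congr rfl fun i _ => ?_
  have h1 : (fun y => fderiv ℝ (fun y => u y ^ 2) y (b i))
      =ᶠ[nhds x] fun y => 2 * (u y * fderiv ℝ u y (b i)) := by
    filter_upwards [hu.eventually (by simp)] with y hy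
    have := (hy.differentiableAt two_ne_zero).hasFDerivAt.pow 2
    rw [this.fderiv]
    simp
    ring
  have hd : DifferentiableAt ℝ u x := hu.differentiableAt two_ne_zero
  have hd2 := hu.differentiableAt_fderiv_apply (b i)
  rw [h1.fderiv_eq, fderiv_const_mul (hd.fun_mul hd2), fderiv_fun_mul hd hd2]
  simp
  ring

variable [MeasurableSpace E] [BorelSpace E] [Nontrivial E] {u : E → ℝ} {U : Set E}

/-- Directional derivatives of harmonic functions are harmonic. -/
theorem InnerProductSpace.HarmonicOnNhd.fderiv_apply (hU : IsOpen U) (hu : HarmonicOnNhd u U)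
    (v : E) : HarmonicOnNhd (fun x => fderiv ℝ u x v) U := by
  have hs : ContDiffOn ℝ ∞ u U := contDiffOn_infty_of_harmonicOnNhd hU hu
  have hd : ∀ v, ContDiffOn ℝ ∞ (fun x => fderiv ℝ u x v) U := fun v =>
    hs.fderiv_apply_of_isOpen hU (by simp) v
  have h2 : ∀ {w : E → ℝ}, ContDiffOn ℝ ∞ w U → ∀ x ∈ U, ContDiffAt ℝ 2 w x := fun hw x hx =>
    (contDiffOn_infty.1 hw 2).contDiffAt (hU.mem_nhds hx)
  set b := stdOrthonormalBasis ℝ E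
  intro x hx
  refine ⟨h2 (hd v) x hx, Filter.eventually_of_mem (hU.mem_nhds hx) fun z hz => ?_⟩
  have hzero : (fun y => ∑ i, fderiv ℝ (fun y => fderiv ℝ u y (b i)) y (b i))
      =ᶠ[nhds z] fun _ => 0 := by
    filter_upwards [hU.mem_nhds hz] with y hy
    rw [← laplacian_eq_sum_fderiv_fderiv b (h2 hs y hy)]
    exact (hu y hy).2.eq_of_nhds
  have hswap : ∀ i, fderiv ℝ (fun y => fderiv ℝ (fun y => fderiv ℝ u y v) y (b i)) z (b i)
      = fderiv ℝ (fun y => fderiv ℝ (fun y => fderiv ℝ u y (b i)) y (b i)) z v := fun i => by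
    have : (fun y => fderiv ℝ (fun y => fderiv ℝ u y v) y (b i))
        =ᶠ[nhds z] fun y => fderiv ℝ (fun y => fderiv ℝ u y (b i)) y v := by
      filter_upwards [hU.mem_nhds hz] with y hy
      exact (h2 hs y hy).fderiv_fderiv_apply_comm _ _
    rw [this.fderiv_eq]
    exact (h2 (hd (b i)) z hz).fderiv_fderiv_apply_comm _ _
  rw [laplacian_eq_sum_fderiv_fderiv b (h2 (hd v) z hz), Finset.sum_congr rfl fun i _ => hswap i]
  have hsum := congrArg (fun L : E →L[ℝ] ℝ => L v) hzero.fderiv_eq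
  rw [fderiv_fun_sum fun i _ => (h2 (hd (b i)) z hz).differentiableAt_fderiv_apply _] at hsum
  simpa using hsum

/-- The derivative of the spherical means of `u ^ 2`, in terms of the spherical means of the
squared partial derivatives of `u`. -/
theorem hasDerivAt_sphereIntegral_sq {R : ℝ} (hu : HarmonicOnNhd u (ball (0 : E) R)) {r : ℝ}
    (hr : r ∈ Ioo 0 R) :
    HasDerivAt (sphereIntegral fun x => u x ^ 2)
      (r * ∑ i, 2 * ∫ t in Ioo (0 : ℝ) 1, t ^ (Module.finrank ℝ E - 1) *
        sphereIntegral (fun x => fderiv ℝ u x (stdOrthonormalBasis ℝ E i) ^ 2) (r * t)) r := by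
  set n := Module.finrank ℝ E - 1
  set b := stdOrthonormalBasis ℝ E
  have hs : ContDiffOn ℝ ∞ u (ball 0 R) := contDiffOn_infty_of_harmonicOnNhd isOpen_ball hu
  have hs2 : ContDiffOn ℝ 2 u (ball 0 R) := contDiffOn_infty.1 hs 2
  have hb : ∀ i, ContinuousOn (fun x => fderiv ℝ u x (b i) ^ 2) (ball 0 R) := fun i =>
    ((hs2.of_le one_le_two).continuousOn_fderiv_apply isOpen_ball (b i)).pow 2
  have hsub : ∀ t ∈ Icc (0 : ℝ) 1, r * t ∈ Ioo (-R) R := fun t ht =>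
    ⟨by nlinarith [ht.1, hr.1, hr.2], by nlinarith [ht.2, hr.1, hr.2]⟩
  have hlap : ∀ s ∈ Ioo (-R) R, sphereIntegral (Δ fun x => u x ^ 2) s
      = ∑ i, 2 * sphereIntegral (fun x => fderiv ℝ u x (b i) ^ 2) s := fun s hs' => by
    simp only [sphereIntegral, ← integral_const_mul]
    rw [← integral_finsetSum _ fun i _ => (integrable_smul_sphere (hb i) hs').const_mul 2]
    refine integral_congr_ae (Filter.Eventually.of_forall fun θ => ?_)
    have hθ := smul_sphere_mem_ball hs' θ
    simp only
    rw [laplacian_sq (hs2.contDiffAt (isOpen_ball.mem_nhds hθ)) b, (hu _ hθ).2.eq_of_nhds]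
    simp
  have hint : ∀ i, IntegrableOn (fun t : ℝ => t ^ n *
      sphereIntegral (fun x => fderiv ℝ u x (b i) ^ 2) (r * t)) (Ioo 0 1) := fun i => by
    refine IntegrableOn.mono_set (ContinuousOn.integrableOn_compact isCompact_Icc ?_)
      Ioo_subset_Icc_self
    exact (continuous_pow n).continuousOn.fun_mul
      ((continuousOn_sphereIntegral (hb i)).comp (by fun_prop) hsub)
  have hsq : ContDiffOn ℝ 2 (fun x => u x ^ 2) (ball 0 R) := hs2.pow 2
  convert hasDerivAt_sphereIntegral (hsq.of_le one_le_two)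
    (⟨by linarith [hr.1, hr.2], hr.2⟩ : r ∈ Ioo (-R) R) using 1
  refine mul_left_cancel₀ (pow_ne_zero n hr.1.ne') ?_
  rw [pow_mul_integral_fderiv_sphere hsq hr]
  have hscale := intervalIntegral.mul_integral_comp_mul_left (a := 0) (b := 1)
    (f := fun s => s ^ n * sphereIntegral (Δ fun x => u x ^ 2) s) r
  rw [mul_zero, mul_one] at hscale
  rw [← hscale, intervalIntegral.integral_of_le zero_le_one, integral_Ioc_eq_integral_Ioo,
    setIntegral_congr_fun measurableSet_Ioo (g := fun t => r ^ n * ∑ i, 2 * (t ^ n *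
      sphereIntegral (fun x => fderiv ℝ u x (b i) ^ 2) (r * t))) fun t ht => ?_]
  · rw [integral_const_mul, integral_finsetSum _ fun i _ => (hint i).const_mul 2]
    simp only [integral_const_mul]
    ring
  · simp only [hlap _ (hsub t ⟨ht.1.le, ht.2.le⟩), mul_pow, Finset.mul_sum]
    exact Finset.sum_congr rfl fun i _ => by ring

end Harmonic

/-! ### Absolutely monotone functions of finite order -/

section AbsMonotone

/-- `f` is continuous and nonnegative on `(0, 1)` and bounded near `0`. -/
structure NonnegBoundedNearZero (f : ℝ → ℝ) : Prop where
  continuousOn : ContinuousOn f (Ioo 0 1)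
  nonneg : ∀ r ∈ Ioo (0 : ℝ) 1, 0 ≤ f r
  bounded : ∀ r ∈ Ioo (0 : ℝ) 1, ∃ C, ∀ s ∈ Ioc 0 r, f s ≤ C

/-- The derivatives of `f` of order at most `n` on `(0, 1)` exist, and are continuous, nonnegative
and bounded near `0`. Boundedness near `0` is what allows differentiation under the integral in
`AbsMonotoneUpTo.scaleAverage`. -/
def AbsMonotoneUpTo : ℕ → (ℝ → ℝ) → Prop
  | 0, f => NonnegBoundedNearZero f
  | n + 1, f => NonnegBoundedNearZero f ∧
      ∃ f' : ℝ → ℝ, (∀ r ∈ Ioo (0 : ℝ) 1, HasDerivAt f (f' r) r) ∧ AbsMonotoneUpTo n f'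

/-- The average `r ↦ ∫₀¹ g(t) f(rt) dt` of the dilates of `f` with weight `g`. -/
noncomputable def scaleAverage (g f : ℝ → ℝ) (r : ℝ) : ℝ :=
  ∫ t in Ioo (0 : ℝ) 1, g t * f (r * t)

variable {f f₁ f₂ g : ℝ → ℝ} {n : ℕ}

theorem mul_mem_Ioc_of_mem_Ioo {s r t : ℝ} (hs : s ∈ Ioc 0 r) (ht : t ∈ Ioo (0 : ℝ) 1) :
    s * t ∈ Ioc 0 r :=
  ⟨mul_pos hs.1 ht.1, (mul_le_of_le_one_right hs.1.le ht.2.le).trans hs.2⟩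

theorem Ioc_subset_Ioo_of_mem {r : ℝ} (hr : r ∈ Ioo (0 : ℝ) 1) : Ioc 0 r ⊆ Ioo 0 1 :=
  fun _ hs => ⟨hs.1, hs.2.trans_lt hr.2⟩

namespace NonnegBoundedNearZero

theorem const {c : ℝ} (hc : 0 ≤ c) : NonnegBoundedNearZero fun _ => c :=
  ⟨continuousOn_const, fun _ _ => hc, fun _ _ => ⟨c, fun _ _ => le_rfl⟩⟩

theorem fun_add (h₁ : NonnegBoundedNearZero f₁) (h₂ : NonnegBoundedNearZero f₂) :
    NonnegBoundedNearZero fun r => f₁ r + f₂ r := by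
  refine ⟨h₁.continuousOn.add h₂.continuousOn, fun r hr => add_nonneg (h₁.nonneg r hr)
    (h₂.nonneg r hr), fun r hr => ?_⟩
  obtain ⟨C₁, hC₁⟩ := h₁.bounded r hr
  obtain ⟨C₂, hC₂⟩ := h₂.bounded r hr
  exact ⟨C₁ + C₂, fun s hs => add_le_add (hC₁ s hs) (hC₂ s hs)⟩

theorem fun_mul (h₁ : NonnegBoundedNearZero f₁) (h₂ : NonnegBoundedNearZero f₂) :
    NonnegBoundedNearZero fun r => f₁ r * f₂ r := by
  refine ⟨h₁.continuousOn.mul h₂.continuousOn, fun r hr => mul_nonneg (h₁.nonneg r hr)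
    (h₂.nonneg r hr), fun r hr => ?_⟩
  obtain ⟨C₁, hC₁⟩ := h₁.bounded r hr
  obtain ⟨C₂, hC₂⟩ := h₂.bounded r hr
  refine ⟨C₁ * C₂, fun s hs => ?_⟩
  have hs' := Ioc_subset_Ioo_of_mem hr hs
  exact mul_le_mul (hC₁ s hs) (hC₂ s hs) (h₂.nonneg s hs') ((h₁.nonneg s hs').trans (hC₁ s hs))

theorem id : NonnegBoundedNearZero fun r => r :=
  ⟨continuousOn_id, fun _ hr => hr.1.le, fun r _ => ⟨r, fun _ hs => hs.2⟩⟩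

theorem norm_le (h : NonnegBoundedNearZero f) {r : ℝ} (hr : r ∈ Ioo (0 : ℝ) 1) :
    ∃ C, 0 ≤ C ∧ ∀ s ∈ Ioc 0 r, ‖f s‖ ≤ C := by
  obtain ⟨C, hC⟩ := h.bounded r hr
  have h0 : ∀ s ∈ Ioc 0 r, ‖f s‖ ≤ C := fun s hs => by
    rw [Real.norm_of_nonneg (h.nonneg s (Ioc_subset_Ioo_of_mem hr hs))]
    exact hC s hs
  exact ⟨C, (norm_nonneg _).trans (h0 r ⟨hr.1, le_rfl⟩), h0⟩

theorem aestronglyMeasurable_mul_comp (h : NonnegBoundedNearZero f)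
    (hg : IntegrableOn g (Ioo 0 1)) {r : ℝ} (hr : r ∈ Ioo (0 : ℝ) 1) :
    AEStronglyMeasurable (fun t => g t * f (r * t)) (volume.restrict (Ioo 0 1)) := by
  refine hg.aestronglyMeasurable.mul (ContinuousOn.aestronglyMeasurable ?_ measurableSet_Ioo)
  exact h.continuousOn.comp (by fun_prop) fun t ht =>
    Ioc_subset_Ioo_of_mem hr (mul_mem_Ioc_of_mem_Ioo ⟨hr.1, le_rfl⟩ ht)

theorem integrableOn_mul_comp (h : NonnegBoundedNearZero f)
    (hg : IntegrableOn g (Ioo 0 1)) {r : ℝ} (hr : r ∈ Ioo (0 : ℝ) 1) :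
    IntegrableOn (fun t => g t * f (r * t)) (Ioo 0 1) := by
  obtain ⟨C, -, hC⟩ := h.norm_le hr
  refine Integrable.mono' (hg.norm.mul_const C) (h.aestronglyMeasurable_mul_comp hg hr) ?_
  filter_upwards [ae_restrict_mem measurableSet_Ioo] with t ht
  rw [norm_mul]
  exact mul_le_mul_of_nonneg_left (hC _ (mul_mem_Ioc_of_mem_Ioo ⟨hr.1, le_rfl⟩ ht)) (norm_nonneg _)

theorem scaleAverage (h : NonnegBoundedNearZero f) (hg : IntegrableOn g (Ioo 0 1))
    (hg0 : ∀ t ∈ Ioo (0 : ℝ) 1, 0 ≤ g t) : NonnegBoundedNearZero (scaleAverage g f) := by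
  refine ⟨fun r hr => ContinuousAt.continuousWithinAt ?_, fun r hr => ?_, fun r hr => ?_⟩
  · obtain ⟨a, hra, ha1⟩ := exists_between hr.2
    have ha : a ∈ Ioo (0 : ℝ) 1 := ⟨hr.1.trans hra, ha1⟩
    obtain ⟨C, -, hC⟩ := h.norm_le ha
    have hnhds : Ioo 0 a ∈ nhds r := Ioo_mem_nhds hr.1 hra
    refine continuousAt_of_dominated (bound := fun t => ‖g t‖ * C) ?_ ?_ (hg.norm.mul_const C) ?_
    · filter_upwards [hnhds] with s hs
      exact h.aestronglyMeasurable_mul_comp hg ⟨hs.1, hs.2.trans ha1⟩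
    · filter_upwards [hnhds] with s hs
      filter_upwards [ae_restrict_mem measurableSet_Ioo] with t ht
      rw [norm_mul]
      exact mul_le_mul_of_nonneg_left (hC _ (mul_mem_Ioc_of_mem_Ioo ⟨hs.1, hs.2.le⟩ ht))
        (norm_nonneg _)
    · filter_upwards [ae_restrict_mem measurableSet_Ioo] with t ht
      have hmem := Ioc_subset_Ioo_of_mem hr (mul_mem_Ioc_of_mem_Ioo ⟨hr.1, le_rfl⟩ ht)
      exact continuousAt_const.mul (ContinuousAt.comp (f := fun s => s * t)
        (h.continuousOn.continuousAt (isOpen_Ioo.mem_nhds hmem)) (by fun_prop))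
  · refine setIntegral_nonneg measurableSet_Ioo fun t ht => mul_nonneg (hg0 t ht) ?_
    exact h.nonneg _ (Ioc_subset_Ioo_of_mem hr (mul_mem_Ioc_of_mem_Ioo ⟨hr.1, le_rfl⟩ ht))
  · obtain ⟨C, hC⟩ := h.bounded r hr
    refine ⟨∫ t in Ioo (0 : ℝ) 1, g t * C, fun s hs => ?_⟩
    refine setIntegral_mono_on (h.integrableOn_mul_comp hg (Ioc_subset_Ioo_of_mem hr hs))
      (hg.mul_const C) measurableSet_Ioo fun t ht => ?_
    exact mul_le_mul_of_nonneg_left (hC _ (mul_mem_Ioc_of_mem_Ioo hs ht)) (hg0 t ht)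

end NonnegBoundedNearZero

/-- Differentiation of dilates under the integral sign. -/
theorem hasDerivAt_scaleAverage {f' : ℝ → ℝ} (h : NonnegBoundedNearZero f)
    (hd : ∀ r ∈ Ioo (0 : ℝ) 1, HasDerivAt f (f' r) r) (h' : NonnegBoundedNearZero f')
    (hg : IntegrableOn g (Ioo 0 1)) (hg' : IntegrableOn (fun t => g t * t) (Ioo 0 1)) {r : ℝ}
    (hr : r ∈ Ioo (0 : ℝ) 1) :
    HasDerivAt (scaleAverage g f) (scaleAverage (fun t => g t * t) f' r) r := by
  obtain ⟨a, hra, ha1⟩ := exists_between hr.2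
  have ha : a ∈ Ioo (0 : ℝ) 1 := ⟨hr.1.trans hra, ha1⟩
  obtain ⟨C, -, hC⟩ := h'.norm_le ha
  have hnhds : Ioo 0 a ∈ nhds r := Ioo_mem_nhds hr.1 hra
  refine (hasDerivAt_integral_of_dominated_loc_of_deriv_le (bound := fun t => ‖g t * t‖ * C)
    (F := fun s t => g t * f (s * t)) (F' := fun s t => g t * t * f' (s * t))
    (μ := volume.restrict (Ioo 0 1))
    hnhds ?_ (h.integrableOn_mul_comp hg hr) (h'.aestronglyMeasurable_mul_comp hg' hr) ?_
    (hg'.norm.mul_const C) ?_).2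
  · filter_upwards [hnhds] with s hs
    exact h.aestronglyMeasurable_mul_comp hg ⟨hs.1, hs.2.trans ha1⟩
  · filter_upwards [ae_restrict_mem measurableSet_Ioo] with t ht s hs
    rw [norm_mul]
    exact mul_le_mul_of_nonneg_left (hC _ (mul_mem_Ioc_of_mem_Ioo ⟨hs.1, hs.2.le⟩ ht))
      (norm_nonneg _)
  · filter_upwards [ae_restrict_mem measurableSet_Ioo] with t ht s hs
    have hmem := Ioc_subset_Ioo_of_mem ha (mul_mem_Ioc_of_mem_Ioo ⟨hs.1, hs.2.le⟩ ht)
    have h1 := ((hd _ hmem).comp s (hasDerivAt_mul_const t)).const_mul (g t)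
    rw [mul_comm (f' (s * t)), ← mul_assoc] at h1
    exact h1

namespace AbsMonotoneUpTo

theorem nonnegBoundedNearZero (h : AbsMonotoneUpTo n f) : NonnegBoundedNearZero f := by
  cases n with
  | zero => exact h
  | succ n => exact h.1

theorem of_succ (h : AbsMonotoneUpTo (n + 1) f) : AbsMonotoneUpTo n f := by
  induction n generalizing f with
  | zero => exact h.1
  | succ n ih =>
    obtain ⟨h0, f', hd, h'⟩ := h
    exact ⟨h0, f', hd, ih h'⟩

theorem zero : AbsMonotoneUpTo n fun _ => 0 := by
  induction n with
  | zero => exact .const le_rfl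
  | succ n ih => exact ⟨.const le_rfl, fun _ => 0, fun r _ => hasDerivAt_const r 0, ih⟩

theorem fun_add (h₁ : AbsMonotoneUpTo n f₁) (h₂ : AbsMonotoneUpTo n f₂) :
    AbsMonotoneUpTo n fun r => f₁ r + f₂ r := by
  induction n generalizing f₁ f₂ with
  | zero => exact NonnegBoundedNearZero.fun_add h₁ h₂
  | succ n ih =>
    obtain ⟨h₁0, f₁', hd₁, h₁'⟩ := h₁
    obtain ⟨h₂0, f₂', hd₂, h₂'⟩ := h₂
    exact ⟨h₁0.fun_add h₂0, _, fun r hr => (hd₁ r hr).add (hd₂ r hr), ih h₁' h₂'⟩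

theorem fun_sum {ι : Type*} (s : Finset ι) {F : ι → ℝ → ℝ}
    (h : ∀ i ∈ s, AbsMonotoneUpTo n (F i)) : AbsMonotoneUpTo n fun r => ∑ i ∈ s, F i r := by
  classical
  induction s using Finset.induction_on with
  | empty => simpa using zero
  | insert i s hi ih =>
    simp only [Finset.sum_insert hi]
    exact (h i (Finset.mem_insert_self i s)).fun_add
      (ih fun j hj => h j (Finset.mem_insert_of_mem hj))

theorem const_mul {c : ℝ} (hc : 0 ≤ c) (h : AbsMonotoneUpTo n f) :
    AbsMonotoneUpTo n fun r => c * f r := by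
  induction n generalizing f with
  | zero => exact (NonnegBoundedNearZero.const hc).fun_mul h
  | succ n ih =>
    obtain ⟨h0, f', hd, h'⟩ := h
    exact ⟨(NonnegBoundedNearZero.const hc).fun_mul h0, _, fun r hr => (hd r hr).const_mul c, ih h'⟩

theorem id_mul (h : AbsMonotoneUpTo n f) : AbsMonotoneUpTo n fun r => r * f r := by
  induction n generalizing f with
  | zero => exact NonnegBoundedNearZero.id.fun_mul h
  | succ n ih =>
    have hn := h.of_succ
    obtain ⟨h0, f', hd, h'⟩ := h
    refine ⟨NonnegBoundedNearZero.id.fun_mul h0, fun r => f r + r * f' r, fun r hr => ?_,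
      hn.fun_add (ih h')⟩
    simpa using (hasDerivAt_id r).fun_mul (hd r hr)

theorem pow_mul (k : ℕ) (h : AbsMonotoneUpTo n f) : AbsMonotoneUpTo n fun r => r ^ k * f r := by
  induction k with
  | zero => simpa using h
  | succ k ih => simpa only [pow_succ', mul_assoc] using ih.id_mul

theorem scaleAverage (h : AbsMonotoneUpTo n f) (hg : IntegrableOn g (Ioo 0 1))
    (hg0 : ∀ t ∈ Ioo (0 : ℝ) 1, 0 ≤ g t) : AbsMonotoneUpTo n (scaleAverage g f) := by
  induction n generalizing f g with
  | zero => exact NonnegBoundedNearZero.scaleAverage h hg hg0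
  | succ n ih =>
    obtain ⟨h0, f', hd, h'⟩ := h
    have hg' : IntegrableOn (fun t => g t * t) (Ioo 0 1) :=
      Integrable.mono' hg.norm (hg.aestronglyMeasurable.mul (by fun_prop)) (by
        filter_upwards [ae_restrict_mem measurableSet_Ioo] with t ht
        rw [norm_mul, Real.norm_of_nonneg ht.1.le]
        exact mul_le_of_le_one_right (norm_nonneg _) ht.2.le)
    exact ⟨h0.scaleAverage hg hg0, _,
      fun r hr => hasDerivAt_scaleAverage h0 hd h'.nonnegBoundedNearZero hg hg' hr,
      ih h' hg' fun t ht => mul_nonneg (hg0 t ht) ht.1.le⟩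

theorem contDiffOn_and_iteratedDerivWithin_nonneg (h : AbsMonotoneUpTo n f) :
    ContDiffOn ℝ n f (Ioo 0 1) ∧ ∀ r ∈ Ioo (0 : ℝ) 1, 0 ≤ iteratedDerivWithin n f (Ioo 0 1) r := by
  have hu : UniqueDiffOn ℝ (Ioo (0 : ℝ) 1) := uniqueDiffOn_Ioo 0 1
  induction n generalizing f with
  | zero =>
    refine ⟨by simpa using h.continuousOn, fun r hr => ?_⟩
    rw [iteratedDerivWithin_zero]
    exact h.nonneg r hr
  | succ n ih =>
    obtain ⟨-, f', hd, h'⟩ := h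
    have heq : EqOn (derivWithin f (Ioo 0 1)) f' (Ioo 0 1) := fun r hr =>
      (hd r hr).hasDerivWithinAt.derivWithin (hu r hr)
    obtain ⟨hc, hn⟩ := ih h'
    refine ⟨?_, fun r hr => ?_⟩
    · push_cast
      exact (contDiffOn_succ_iff_derivWithin hu).2
        ⟨fun r hr => (hd r hr).differentiableAt.differentiableWithinAt, by simp, hc.congr heq⟩
    · rw [iteratedDerivWithin_succ', iteratedDerivWithin_congr heq hr]
      exact hn r hr

end AbsMonotoneUpTo

theorem absolutelyMonotoneOn_of_forall_absMonotoneUpTo (h : ∀ n, AbsMonotoneUpTo n f) :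
    AbsolutelyMonotoneOn f (Ioo 0 1) :=
  (AbsolutelyMonotoneOn.iff_iteratedDerivWithin_nonneg (uniqueDiffOn_Ioo 0 1)).2
    ⟨contDiffOn_infty.2 fun n => (h n).contDiffOn_and_iteratedDerivWithin_nonneg.1,
      fun n => (h n).contDiffOn_and_iteratedDerivWithin_nonneg.2⟩

theorem AbsolutelyMonotoneOn.congr_of_eqOn {s : Set ℝ} (h : AbsolutelyMonotoneOn f s)
    (hfg : EqOn g f s) : AbsolutelyMonotoneOn g s := by
  obtain ⟨p, hp, hn⟩ := h
  exact ⟨p, hp.congr hfg, hn⟩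

end AbsMonotone

/-! ### Spherical and weighted means of squares of harmonic functions -/

section SphericalMeans

open InnerProductSpace

/-- The induction is over all harmonic functions at once: the derivative of the spherical means of
`u ^ 2` is built from those of the squared partial derivatives, which are harmonic again. -/
theorem absMonotoneUpTo_sphereIntegral_sq {E : Type*} [NormedAddCommGroup E]
    [InnerProductSpace ℝ E] [FiniteDimensional ℝ E] [MeasurableSpace E] [BorelSpace E]
    [Nontrivial E] (n : ℕ) {u : E → ℝ} (hu : HarmonicOnNhd u (ball (0 : E) 1)) :
    AbsMonotoneUpTo n (sphereIntegral fun x => u x ^ 2) := by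
  have hbase : ∀ {u : E → ℝ}, HarmonicOnNhd u (ball (0 : E) 1) →
      NonnegBoundedNearZero (sphereIntegral fun x => u x ^ 2) := by
    intro u hu
    have hc : ContinuousOn (sphereIntegral fun x => u x ^ 2) (Ioo (-1) 1) :=
      continuousOn_sphereIntegral (hu.continuousOn.pow 2)
    refine ⟨hc.mono (Ioo_subset_Ioo_left (by norm_num)),
      fun r _ => integral_nonneg fun θ => sq_nonneg _, fun r hr => ?_⟩
    obtain ⟨C, hC⟩ := isCompact_Icc.exists_bound_of_continuousOn
      (hc.mono fun s (hs : s ∈ Icc 0 r) => ⟨by linarith [hs.1], hs.2.trans_lt hr.2⟩)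
    exact ⟨C, fun s hs => (Real.le_norm_self _).trans (hC s ⟨hs.1.le, hs.2⟩)⟩
  induction n generalizing u with
  | zero => exact hbase hu
  | succ n ih =>
    refine ⟨hbase hu, _, fun r hr => hasDerivAt_sphereIntegral_sq hu hr, ?_⟩
    refine (AbsMonotoneUpTo.fun_sum _ fun i _ => ?_).id_mul
    exact ((ih (hu.fderiv_apply isOpen_ball _)).scaleAverage
      (((continuous_pow _).continuousOn.integrableOn_compact isCompact_Icc).mono_set
        Ioo_subset_Icc_self) fun t ht => pow_nonneg ht.1.le _).const_mul zero_le_two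

variable {m : ℕ} {u : EuclideanSpace ℝ (Fin m) → ℝ} {φ : ℝ → ℝ}

theorem continuousOn_weightedIntegrand (hu : ContinuousOn u (ball 0 1))
    (hφ : ContDiffOn ℝ ∞ φ (Icc 0 1)) {r : ℝ} (hr : r ∈ Ioo (0 : ℝ) 1) :
    ContinuousOn (weightedIntegrand u φ r) (closedBall 0 1) := by
  have hφ' : ContinuousOn (derivWithin φ (Icc 0 1)) (Icc 0 1) :=
    hφ.continuousOn_derivWithin (uniqueDiffOn_Icc zero_lt_one) (by simp)
  refine ContinuousOn.mul (ContinuousOn.pow (hu.comp (by fun_prop) fun x hx => ?_) 2)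
    (hφ'.comp (by fun_prop) fun x hx => ?_)
  · rw [mem_closedBall_zero_iff] at hx
    rw [mem_ball_zero_iff, norm_smul, Real.norm_of_nonneg hr.1.le]
    exact (mul_le_of_le_one_right hr.1.le hx).trans_lt hr.2
  · rw [mem_closedBall_zero_iff] at hx
    exact ⟨by positivity, pow_le_one₀ (norm_nonneg _) hx⟩

theorem integrableOn_weightedIntegrand (hu : ContinuousOn u (ball 0 1))
    (hφ : ContDiffOn ℝ ∞ φ (Icc 0 1)) {r : ℝ} (hr : r ∈ Ioo (0 : ℝ) 1) :
    IntegrableOn (weightedIntegrand u φ r) (ball 0 1) :=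
  ((continuousOn_weightedIntegrand hu hφ hr).integrableOn_compact
    (isCompact_closedBall _ _)).mono_set ball_subset_closedBall

/-- In polar coordinates the weighted mean is an average of dilates of the spherical means. -/
theorem weightedMean_eq_scaleAverage [Nontrivial (EuclideanSpace ℝ (Fin m))]
    (hu : ContinuousOn u (ball 0 1)) (hφ : ContDiffOn ℝ ∞ φ (Icc 0 1)) {r : ℝ}
    (hr : r ∈ Ioo (0 : ℝ) 1) :
    weightedMean u φ r =
      scaleAverage (fun t => t ^ (m - 1) * derivWithin φ (Icc 0 1) (t ^ 2))
        (sphereIntegral fun x => u x ^ 2) r := by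
  rw [weightedMean, ← integral_indicator measurableSet_ball, integral_eq_integral_sphereIntegral
    ((integrableOn_weightedIntegrand hu hφ hr).integrable_indicator measurableSet_ball),
    finrank_euclideanSpace_fin, scaleAverage]
  have hnorm : ∀ (t : ℝ) (θ : sphere (0 : EuclideanSpace ℝ (Fin m)) 1),
      ‖t • (θ : EuclideanSpace ℝ (Fin m))‖ = |t| := fun t θ => by simp [norm_smul]
  rw [setIntegral_eq_of_subset_of_forall_sdiff_eq_zero measurableSet_Ioi
    (Ioo_subset_Ioi_self : Ioo (0 : ℝ) 1 ⊆ Ioi 0) fun t ht => ?_]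
  · refine setIntegral_congr_fun measurableSet_Ioo fun t ht => ?_
    simp only [mul_assoc]
    congr 1
    rw [sphereIntegral, sphereIntegral, ← integral_const_mul]
    refine integral_congr_ae (Filter.Eventually.of_forall fun θ => ?_)
    have hmem : t • (θ : EuclideanSpace ℝ (Fin m)) ∈ ball (0 : EuclideanSpace ℝ (Fin m)) 1 := by
      rw [mem_ball_zero_iff, hnorm, abs_of_pos ht.1]
      exact ht.2
    simp only [indicator_of_mem hmem, weightedIntegrand, hnorm, sq_abs, smul_smul]
    ring
  · have h1 : 1 ≤ t := by
      by_contra h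
      exact ht.2 ⟨ht.1, not_le.1 h⟩
    have hnot : ∀ θ : sphere (0 : EuclideanSpace ℝ (Fin m)) 1,
        t • (θ : EuclideanSpace ℝ (Fin m)) ∉ ball (0 : EuclideanSpace ℝ (Fin m)) 1 := fun θ => by
      rw [mem_ball_zero_iff, hnorm, not_lt]
      exact h1.trans (le_abs_self t)
    simp [sphereIntegral, indicator_of_notMem (hnot _)]

theorem measurableEmbedding_smul_sphere {r : ℝ} (hr : r ≠ 0) :
    MeasurableEmbedding fun θ : sphere (0 : EuclideanSpace ℝ (Fin m)) 1 =>
      r • (θ : EuclideanSpace ℝ (Fin m)) :=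
  (Homeomorph.smulOfNeZero r hr).measurableEmbedding.comp
    (MeasurableEmbedding.subtype_coe isClosed_sphere.measurableSet)

theorem integrable_surfaceMeasure {f : EuclideanSpace ℝ (Fin m) → ℝ}
    (hf : ContinuousOn f (ball 0 1)) {r : ℝ} (hr : r ∈ Ioo (0 : ℝ) 1) :
    Integrable f (surfaceMeasure m r) :=
  Integrable.smul_measure ((measurableEmbedding_smul_sphere hr.1.ne').integrable_map_iff.2
    (integrable_smul_sphere hf ⟨by linarith [hr.1], hr.2⟩)) ENNReal.ofReal_ne_top

theorem integral_surfaceMeasure (f : EuclideanSpace ℝ (Fin m) → ℝ) {r : ℝ} (hr : 0 < r) :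
    ∫ x, f x ∂(surfaceMeasure m r) = r ^ (m - 1) * sphereIntegral f r := by
  rw [surfaceMeasure, integral_smul_measure,
    (measurableEmbedding_smul_sphere hr.ne').integral_map,
    ENNReal.toReal_ofReal (pow_nonneg hr.le _), smul_eq_mul, sphereIntegral]

/-- The weight `r ^ (m - 1)` cancels, so `sphereHbar u` is a constant multiple of the spherical mean
of `u ^ 2`. -/
theorem sphereHbar_eq {r : ℝ} (hr : 0 < r) :
    sphereHbar u r = ((volume : Measure (EuclideanSpace ℝ (Fin m))).toSphere.real univ)⁻¹ *
      sphereIntegral (fun x => u x ^ 2) r := by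
  have h1 : (surfaceMeasure m r).real univ =
      r ^ (m - 1) * (volume : Measure (EuclideanSpace ℝ (Fin m))).toSphere.real univ := by
    have := integral_surfaceMeasure (m := m) (fun _ => 1) hr
    simpa [sphereIntegral] using this
  rw [sphereHbar, sphereH, integral_surfaceMeasure _ hr, h1,
    mul_div_mul_left _ _ (pow_pos hr _).ne', div_eq_inv_mul]

end SphericalMeans

theorem proposition5p1 (m : ℕ) (hm : 1 ≤ m) (u : EuclideanSpace ℝ (Fin m) → ℝ)
    (hu : InnerProductSpace.HarmonicOnNhd u (ball (0 : EuclideanSpace ℝ (Fin m)) 1)) :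
    (∀ φ : ℝ → ℝ, ContDiffOn ℝ ∞ φ (Icc 0 1) → MonotoneOn φ (Icc 0 1) →
      (∀ r ∈ Ioo (0 : ℝ) 1,
        IntegrableOn (weightedIntegrand u φ r) (ball (0 : EuclideanSpace ℝ (Fin m)) 1)) ∧
      AbsolutelyMonotoneOn (weightedMean u φ) (Ioo 0 1)) ∧
    (∀ r ∈ Ioo (0 : ℝ) 1, Integrable (fun x => u x ^ 2) (surfaceMeasure m r)) ∧
    AbsolutelyMonotoneOn (sphereHbar u) (Ioo 0 1) ∧
    AbsolutelyMonotoneOn (sphereH u) (Ioo 0 1) := by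
  have : NeZero m := ⟨by lia⟩
  have hN := fun n => absMonotoneUpTo_sphereIntegral_sq n hu
  refine ⟨fun φ hφ hmono => ⟨fun r hr => integrableOn_weightedIntegrand hu.continuousOn hφ hr, ?_⟩,
    fun r hr => integrable_surfaceMeasure (hu.continuousOn.pow 2) hr, ?_, ?_⟩
  · refine (absolutelyMonotoneOn_of_forall_absMonotoneUpTo fun n =>
      (hN n).scaleAverage ?_ fun t ht => ?_).congr_of_eqOn
      fun r hr => weightedMean_eq_scaleAverage hu.continuousOn hφ hr
    · have hφ' : ContinuousOn (derivWithin φ (Icc 0 1)) (Icc 0 1) :=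
        hφ.continuousOn_derivWithin (uniqueDiffOn_Icc zero_lt_one) (by simp)
      refine IntegrableOn.mono_set (ContinuousOn.integrableOn_compact isCompact_Icc ?_)
        Ioo_subset_Icc_self
      exact (continuous_pow _).continuousOn.fun_mul (hφ'.comp (by fun_prop) fun t ht =>
        ⟨by positivity, pow_le_one₀ ht.1 ht.2⟩)
    · exact mul_nonneg (pow_nonneg ht.1.le _) hmono.derivWithin_nonneg
  · exact (absolutelyMonotoneOn_of_forall_absMonotoneUpTo fun n =>
      (hN n).const_mul (by positivity)).congr_of_eqOn fun r hr => sphereHbar_eq hr.1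
  · exact (absolutelyMonotoneOn_of_forall_absMonotoneUpTo fun n =>
      (hN n).pow_mul (m - 1)).congr_of_eqOn fun r hr => integral_surfaceMeasure _ hr.1
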